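/- Let $\mathbf{F}_q$ be a finite field with $q$ elements, let $O=\mathbf{F}_q[[T]]$ and $K=\mathbf{F}_q((T))$ with the $T$-adic topology, and let $LC(O,K)$ be the $K$-vector space of continuous $\mathbf{F}_q$-linear functions $f:O\to K$. For $n\ge 0$ let $\mathcal{D}_n$ be the hyper-differential operator $\mathcal{D}_n\left(\sum_i a_iT^i\right)=\sum_i\binom{i}{n}a_iT^{i-n}$, let $\Delta$ be the Carlitz difference operator on $LC(O,K)$ given by $(\Delta f)(x)=f(Tx)-Tf(x)$, let $I$ be the identity operator, and for $m\ge 0$ put $[m]=T^{q^m}-T$. Then for every integer $m\ge 0$ and every $f\in LC(O,K)$ there is exactly one sequence $(\beta_n^{(m)})_{n\ge 0}$ in $K$ such that $$f(x)=\sum_{n=0}^{\infty}\beta_n^{(m)}\,\mathcal{D}_n(x)^{q^m}\qquad\text{for all }x\in O.$$ Moreover $\beta_n^{(m)}\to 0$ as $n\to\infty$, the series converges uniformly on $O$, and for all $n\ge 0$ $$\beta_n^{(m)}=\big((\Delta-[m]I)^nf\big)(1)=\sum_{i=0}^{n}\sum_{j=i}^{n}(-1)^{n-i}\binom{n}{j}[m]^{n-j}f(T^i)\,\mathcal{D}_i(T^j).$$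 -/

import Mathlib

open Filter Topology
open scoped LaurentSeries PowerSeries

noncomputable section

namespace CarlitzExpansion

/-- The topology of `O = F⟦T⟧` as a subspace of the valued field `K = F⸨T⸩` (whose topology comes
from the `T`-adic valuation). -/
instance powerSeriesTopology (F : Type*) [Field F] : TopologicalSpace F⟦X⟧ :=
  TopologicalSpace.induced (fun x : F⟦X⟧ => (x : F⸨X⸩)) inferInstance

/-- The uniformizer `T`, as an element of `K`. -/
def T (F : Type*) [Field F] : F⸨X⸩ := ((PowerSeries.X : F⟦X⟧) : F⸨X⸩)

/-- Scalars from `F` commute with multiplication in `K`. -/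
theorem mul_scalar (F : Type*) [Field F] (a : F) (c d : F⸨X⸩) : c * a • d = a • (c * d) := by
  rw [← HahnSeries.C_mul_eq_smul, ← HahnSeries.C_mul_eq_smul, mul_left_comm]

/-- `LC(O, K)`: the `K`-space of continuous `F`-linear functions from `O` to `K`. -/
def LC (F : Type*) [Field F] : Submodule F⸨X⸩ (F⟦X⟧ → F⸨X⸩) where
  carrier := {f | Continuous f ∧ IsLinearMap F f}
  zero_mem' := ⟨continuous_const, ⟨fun _ _ => by simp, fun _ _ => by simp⟩⟩
  add_mem' := by
    rintro f g ⟨hf, hf'⟩ ⟨hg, hg'⟩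
    exact ⟨hf.add hg, (hf'.mk' f + hg'.mk' g).isLinear⟩
  smul_mem' := by
    rintro c f ⟨hf, hf'⟩
    refine ⟨continuous_const.mul hf, ⟨fun x y => ?_, fun a x => ?_⟩⟩
    · simp [hf'.map_add, mul_add]
    · simp only [Pi.smul_apply, smul_eq_mul, hf'.map_smul, mul_scalar]

/-- Multiplication by `T` is continuous on `O`. -/
theorem continuous_X_mul (F : Type*) [Field F] :
    Continuous (fun x : F⟦X⟧ => (PowerSeries.X : F⟦X⟧) * x) := by
  refine continuous_induced_rng.2 ?_
  have h : Continuous (fun x : F⟦X⟧ => T F * (x : F⸨X⸩)) :=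
    continuous_const.mul continuous_induced_dom
  refine h.congr fun x => ?_
  simp [T]

/-- The Carlitz difference operator `(Δ f)(x) = f (T x) - T f(x)` on `LC(O, K)`. -/
def carlitzDelta (F : Type*) [Field F] : Module.End F⸨X⸩ (LC F) where
  toFun f := ⟨fun x => f.1 ((PowerSeries.X : F⟦X⟧) * x) - T F * f.1 x, by
    obtain ⟨f, hf, hf'⟩ := f
    refine ⟨(hf.comp (continuous_X_mul F)).sub (continuous_const.mul hf),
      ⟨fun x y => ?_, fun a x => ?_⟩⟩
    · simp only [mul_add, hf'.map_add]
      ring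
    · simp only [mul_smul_comm, hf'.map_smul, mul_scalar, smul_sub]⟩
  map_add' f g := by
    ext1
    funext x
    simp only [Submodule.coe_add, Pi.add_apply]
    ring
  map_smul' c f := by
    ext1
    funext x
    simp only [Submodule.coe_smul, Pi.smul_apply, smul_eq_mul, RingHom.id_apply]
    ring

/-- The hyper-differential operator `𝒟_n (∑ a_i T^i) = ∑ (i choose n) a_i T^(i-n)`, as a function
from `O` to `K`. -/
def hyperD (F : Type*) [Field F] (n : ℕ) (x : F⟦X⟧) : F⸨X⸩ :=
  LaurentSeries.hasseDeriv F n (x : F⸨X⸩)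

/-- The Carlitz bracket `[m] = T^(q^m) - T`, where `q` is the number of elements of `F`. -/
def bracket (F : Type*) [Field F] [Fintype F] (m : ℕ) : F⸨X⸩ :=
  T F ^ (Fintype.card F ^ m) - T F

/-- The partial sum `∑_{n < N} b_n 𝒟_n(x)^(q^m)`. -/
def partialSum (F : Type*) [Field F] [Fintype F] (m : ℕ) (b : ℕ → F⸨X⸩) (N : ℕ) (x : F⟦X⟧) :
    F⸨X⸩ :=
  ∑ n ∈ Finset.range N, b n * hyperD F n x ^ (Fintype.card F ^ m)

end CarlitzExpansion

end

/-!
Write `u = T ^ (q ^ m)`, where `q` is the number of elements of `F`, and let `S` be the shift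
`(S f)(x) = f (T x)` on `LC(O, K)`. Since `Δ = S - T` and `[m] = u - T`, the operator `Δ - [m]` is
`S - u`. The binomial theorem for the commuting operators `S` and `u` therefore gives two mutually
inverse relations between the moments `f (T ^ j) = (S ^ j f)(1)` and the numbers
`β n = ((Δ - [m]) ^ n f)(1)`:
`β n = ∑ k ≤ n, (n choose k) (-u) ^ (n - k) f (T ^ k)` and
`f (T ^ j) = ∑ n ≤ j, (j choose n) u ^ (j - n) β n`.

Now `𝒟_n (T ^ j) ^ (q ^ m) = (j choose n) u ^ (j - n)`, as binomial coefficients lie in the prime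
field, so the second relation says exactly that the expansion holds at `x = T ^ j`, where it is a
finite sum. The system is unitriangular, which gives uniqueness.

Continuity of `f` yields `f (T ^ k) → 0`, and since `|u| < 1` the first relation yields `β n → 0`
(`tendsto_diffCoeff`). For uniform convergence, a continuous `F`-linear function which is bounded
by `r` on the powers of `T` is bounded by `r` on all of `O` (`valuation_apply_le`), because the
powers of `T` span a dense subspace; this is applied to `f` minus a partial sum, whose value at
`T ^ j` is a combination with integral coefficients of the `β n` in the tail.

The double sum is the first relation again, with `u ^ (n - i)` expanded by `u = T + [m]`.
-/

noncomputable section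

namespace CarlitzExpansion

open WithZero

/-! ### The valuation on Laurent series -/

section Valuation

variable (F : Type*) [Field F]

theorem hasBasis_nhds_zero :
    (𝓝 (0 : F⸨X⸩)).HasBasis (fun _ : ℕ => True) fun d => {y | Valued.v y ≤ exp (-(d : ℤ))} := by
  refine (Valued.hasBasis_nhds_zero F⸨X⸩ ℤᵐ⁰).to_hasBasis (fun γ _ => ?_) fun d _ => ?_
  · set e : ℤᵐ⁰ := MonoidWithZeroHom.ValueGroup₀.embedding γ.1 with he
    have he0 : e ≠ 0 := by simp [he]
    refine ⟨(1 - log e).toNat, trivial, fun y hy => ?_⟩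
    simp only [Set.mem_ofPred_eq, Valuation.restrict_lt_iff_lt_embedding] at hy ⊢
    refine hy.trans_lt ?_
    change _ < e
    calc exp (-((1 - log e).toNat : ℤ)) < exp (log e) := by rw [exp_lt_exp]; omega
      _ = e := exp_log he0
  · obtain ⟨x, hx⟩ := LaurentSeries.valuation_surjective F (exp (-(d : ℤ)))
    have hx0 : Valued.v.restrict x ≠ 0 := fun h => by
      have h' := MonoidWithZeroHom.ValueGroup₀.restrict₀_eq_zero_iff.1 h
      exact exp_ne_zero (hx.symm.trans h')
    refine ⟨Units.mk0 _ hx0, trivial, fun y hy => ?_⟩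
    have : Valued.v y < Valued.v x := by
      simpa [Valuation.restrict_lt_iff] using hy
    exact hx ▸ this.le

variable {F}

theorem valuation_smul_le (a : F) (y : F⸨X⸩) : Valued.v (a • y) ≤ Valued.v y := by
  rw [← HahnSeries.C_mul_eq_smul, map_mul]
  refine mul_le_of_le_one_left' ?_
  rw [LaurentSeries.val_le_one_iff_eq_coe]
  exact ⟨PowerSeries.C a, by simp⟩

theorem valuation_natCast_le_one (n : ℕ) : Valued.v (n : F⸨X⸩) ≤ 1 :=
  natCast_mem (Valued.v (R := F⸨X⸩)).integer n

theorem valuation_T_pow (s : ℕ) : Valued.v (T F ^ s) = exp (-(s : ℤ)) :=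
  LaurentSeries.valuation_X_pow F s

end Valuation

/-! ### Continuous linear functions on power series -/

section LinearFunctions

variable {F : Type*} [Field F]

theorem exists_valuation_X_pow_mul_le {g : F⟦X⟧ → F⸨X⸩} (hg : g ∈ LC F) (d : ℕ) :
    ∃ M : ℕ, ∀ n, M ≤ n → ∀ x, Valued.v (g (PowerSeries.X ^ n * x)) ≤ exp (-(d : ℤ)) := by
  have h : Tendsto g (𝓝 0) (𝓝 0) := by
    simpa [hg.2.map_zero] using hg.1.tendsto 0
  rw [nhds_induced, PowerSeries.coe_zero] at h
  obtain ⟨M, -, hM⟩ := (((hasBasis_nhds_zero F).comap _).tendsto_iff (hasBasis_nhds_zero F)).1 h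
    d trivial
  refine ⟨M, fun n hn x => hM _ ?_⟩
  refine (LaurentSeries.intValuation_le_iff_coeff_lt_eq_zero F _).2 ?_
  exact PowerSeries.X_pow_dvd_iff.1 ((pow_dvd_pow _ hn).mul_right x)

/-- A continuous linear function is bounded on `O` by its bound on the powers of `T`, since
polynomials are dense and the valuation is nonarchimedean. -/
theorem valuation_apply_le {g : F⟦X⟧ → F⸨X⸩} (hg : g ∈ LC F) {d : ℕ}
    (h : ∀ j : ℕ, Valued.v (g (PowerSeries.X ^ j)) ≤ exp (-(d : ℤ))) (x : F⟦X⟧) :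
    Valued.v (g x) ≤ exp (-(d : ℤ)) := by
  obtain ⟨M, hM⟩ := exists_valuation_X_pow_mul_le hg d
  have htrunc : ((PowerSeries.trunc M x : Polynomial F) : F⟦X⟧) =
      ∑ i ∈ Finset.range M, PowerSeries.coeff i x • (PowerSeries.X : F⟦X⟧) ^ i := by
    ext k
    simp [Polynomial.coeff_coe, PowerSeries.coeff_trunc, PowerSeries.coeff_X_pow]
  rw [PowerSeries.eq_X_pow_mul_shift_add_trunc M x, hg.2.map_add]
  refine Valuation.map_add_le _ (hM M le_rfl _) ?_
  rw [htrunc, ← IsLinearMap.mk'_apply hg.2, map_sum]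
  refine Valuation.map_sum_le _ fun i _ => ?_
  rw [map_smul]
  exact (valuation_smul_le _ _).trans (h i)

/-- The operator `(S f)(x) = f (T x)` on `LC(O, K)`, written as `Δ + T`. -/
def shift (F : Type*) [Field F] : Module.End F⸨X⸩ (LC F) := carlitzDelta F + T F • 1

theorem shift_pow_apply (j : ℕ) (f : LC F) (x : F⟦X⟧) :
    ((shift F ^ j) f).1 x = f.1 (PowerSeries.X ^ j * x) := by
  induction j generalizing x with
  | zero => simp
  | succ j ih =>
    rw [pow_succ', Module.End.mul_apply]
    change ((shift F ^ j) f).1 (PowerSeries.X * x) - T F * ((shift F ^ j) f).1 x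
      + T F * ((shift F ^ j) f).1 x = _
    rw [sub_add_cancel, ih, pow_succ, mul_assoc]

theorem add_smul_one_pow_apply_one (A : Module.End F⸨X⸩ (LC F)) (c : F⸨X⸩) (n : ℕ) (f : LC F) :
    (((A + c • 1) ^ n) f).1 1 =
      ∑ k ∈ Finset.range (n + 1), (n.choose k : F⸨X⸩) * c ^ (n - k) * ((A ^ k) f).1 1 := by
  have hc : Commute A (c • (1 : Module.End F⸨X⸩ (LC F))) := (Commute.one_right A).smul_right c
  rw [hc.add_pow, LinearMap.sum_apply]
  simp only [AddSubmonoidClass.coe_finsetSum, Finset.sum_apply]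
  refine Finset.sum_congr rfl fun k _ => ?_
  rw [smul_pow, one_pow, mul_smul_comm, mul_one, smul_mul_assoc, ← nsmul_eq_mul']
  simp
  ring

end LinearFunctions

/-! ### Powers of hyper-differential operators -/

section HyperDerivative

variable {F : Type*} [Field F]

theorem hyperD_X_pow (n j : ℕ) :
    hyperD F n ((PowerSeries.X : F⟦X⟧) ^ j) = (j.choose n : F⸨X⸩) * T F ^ (j - n) := by
  have h : HahnSeries.ofPowerSeries ℤ F (PowerSeries.X ^ j) = HahnSeries.single (j : ℤ) 1 := by
    simp
  have hT : T F ^ (j - n) = HahnSeries.single ((j - n : ℕ) : ℤ) 1 := by simp [T]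
  rw [hyperD, h, LaurentSeries.hasseDeriv_single, hT, Ring.choose_natCast]
  rcases le_or_gt n j with hn | hn
  · rw [Nat.cast_sub hn, ← map_natCast (HahnSeries.C (Γ := ℤ) (R := F)), HahnSeries.C_apply,
      HahnSeries.single_mul_single, zero_add]
    simp
  · simp [Nat.choose_eq_zero_of_lt hn]

theorem continuous_hyperD (n : ℕ) : Continuous (hyperD F n) := by
  have h : Continuous (LaurentSeries.hasseDeriv F n : F⸨X⸩ →ₗ[F] F⸨X⸩) := by
    refine continuous_of_continuousAt_zero (LaurentSeries.hasseDeriv F n : F⸨X⸩ →ₗ[F] F⸨X⸩) ?_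
    rw [ContinuousAt, map_zero]
    refine ((hasBasis_nhds_zero F).tendsto_iff (hasBasis_nhds_zero F)).2 fun d _ =>
      ⟨d + n, trivial, fun y hy => ?_⟩
    simp only [Set.mem_ofPred_eq, LaurentSeries.valuation_le_iff_coeff_lt_eq_zero] at hy ⊢
    intro k hk
    rw [LaurentSeries.hasseDeriv_coeff, hy _ (by push_cast; omega), smul_zero]
  exact h.comp continuous_induced_dom

variable [Fintype F]

theorem frobeniusAlgHom_pow_apply (m : ℕ) (y : F⸨X⸩) :
    (FiniteField.frobeniusAlgHom F F⸨X⸩ ^ m) y = y ^ Fintype.card F ^ m := by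
  rw [AlgHom.coe_pow, FiniteField.coe_frobeniusAlgHom, pow_iterate]

theorem hyperD_X_pow_pow_card (m n j : ℕ) :
    hyperD F n ((PowerSeries.X : F⟦X⟧) ^ j) ^ Fintype.card F ^ m =
      (j.choose n : F⸨X⸩) * (T F ^ Fintype.card F ^ m) ^ (j - n) := by
  rw [hyperD_X_pow, mul_pow, ← frobeniusAlgHom_pow_apply m (Nat.cast _), map_natCast, pow_right_comm]

theorem hyperD_pow_card_mem_LC (m n : ℕ) :
    (fun x : F⟦X⟧ => hyperD F n x ^ Fintype.card F ^ m) ∈ LC F := by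
  refine ⟨(continuous_hyperD n).pow _, fun x y => ?_, fun c x => ?_⟩
  · simp only [hyperD, map_add, ← frobeniusAlgHom_pow_apply]
  · simp only [hyperD, PowerSeries.coe_smul, map_smul]
    rw [← HahnSeries.C_mul_eq_smul, mul_pow, ← map_pow, FiniteField.pow_card_pow,
      HahnSeries.C_mul_eq_smul]

theorem partialSum_mem_LC (m : ℕ) (b : ℕ → F⸨X⸩) (N : ℕ) : partialSum F m b N ∈ LC F := by
  have h : partialSum F m b N =
      ∑ n ∈ Finset.range N, b n • fun x : F⟦X⟧ => hyperD F n x ^ Fintype.card F ^ m := by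
    ext1 x
    simp [partialSum]
  rw [h]
  exact Submodule.sum_mem _ fun n _ => Submodule.smul_mem _ _ (hyperD_pow_card_mem_LC m n)

theorem partialSum_X_pow (m : ℕ) (b : ℕ → F⸨X⸩) (N j : ℕ) :
    partialSum F m b N (PowerSeries.X ^ j) = ∑ n ∈ Finset.range N,
      (j.choose n : F⸨X⸩) * (T F ^ Fintype.card F ^ m) ^ (j - n) * b n := by
  simp only [partialSum, hyperD_X_pow_pow_card]
  exact Finset.sum_congr rfl fun n _ => mul_comm _ _

/-- At a power of `T` the series is a finite sum. -/
theorem partialSum_X_pow_of_lt (m : ℕ) (b : ℕ → F⸨X⸩) {N j : ℕ} (h : j < N) :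
    partialSum F m b N (PowerSeries.X ^ j) = partialSum F m b (j + 1) (PowerSeries.X ^ j) := by
  rw [partialSum_X_pow, partialSum_X_pow]
  refine (Finset.sum_subset (Finset.range_mono h) fun n _ hn => ?_).symm
  rw [Nat.choose_eq_zero_of_lt (by simpa using hn)]
  simp

end HyperDerivative

/-! ### The coefficients of the expansion -/

section Coefficients

variable {F : Type*} [Field F] [Fintype F]

/-- The coefficient `β n = ((Δ - [m]) ^ n f)(1)` of the expansion of `f`. -/
def diffCoeff (m : ℕ) (f : LC F) (n : ℕ) : F⸨X⸩ :=
  (((carlitzDelta F - bracket F m • (1 : Module.End F⸨X⸩ (LC F))) ^ n) f).1 1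

theorem diffCoeff_eq_sum (m : ℕ) (f : LC F) (n : ℕ) :
    diffCoeff m f n = ∑ k ∈ Finset.range (n + 1),
      (n.choose k : F⸨X⸩) * (-T F ^ Fintype.card F ^ m) ^ (n - k) * f.1 (PowerSeries.X ^ k) := by
  have h : carlitzDelta F - bracket F m • (1 : Module.End F⸨X⸩ (LC F)) =
      shift F + (-T F ^ Fintype.card F ^ m) • 1 := by
    refine LinearMap.ext fun g => Subtype.ext (funext fun x => ?_)
    change (carlitzDelta F g).1 x - bracket F m * g.1 x =
      (carlitzDelta F g).1 x + T F * g.1 x + (-T F ^ Fintype.card F ^ m) * g.1 x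
    rw [bracket]
    ring
  rw [diffCoeff, h, add_smul_one_pow_apply_one]
  simp only [shift_pow_apply, mul_one]

/-- The expansion holds at powers of `T`. -/
theorem partialSum_diffCoeff_X_pow (m : ℕ) (f : LC F) (j : ℕ) :
    partialSum F m (diffCoeff m f) (j + 1) (PowerSeries.X ^ j) = f.1 (PowerSeries.X ^ j) := by
  have h : shift F = (carlitzDelta F - bracket F m • (1 : Module.End F⸨X⸩ (LC F))) +
      (T F ^ Fintype.card F ^ m) • 1 := by
    refine LinearMap.ext fun g => Subtype.ext (funext fun x => ?_)
    change (carlitzDelta F g).1 x + T F * g.1 x =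
      (carlitzDelta F g).1 x - bracket F m * g.1 x + T F ^ Fintype.card F ^ m * g.1 x
    rw [bracket]
    ring
  rw [partialSum_X_pow, ← mul_one (PowerSeries.X ^ j), ← shift_pow_apply, h,
    add_smul_one_pow_apply_one]
  rfl

theorem diffCoeff_eq_double_sum (m : ℕ) (f : LC F) (n : ℕ) :
    diffCoeff m f n = ∑ i ∈ Finset.range (n + 1), ∑ j ∈ Finset.Icc i n,
      (-1 : F⸨X⸩) ^ (n - i) * (n.choose j : F⸨X⸩) * bracket F m ^ (n - j)
        * f.1 ((PowerSeries.X : F⟦X⟧) ^ i) * hyperD F i ((PowerSeries.X : F⟦X⟧) ^ j) := by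
  rw [diffCoeff_eq_sum]
  refine Finset.sum_congr rfl fun i hi => ?_
  have hin : i ≤ n := Nat.lt_succ_iff.1 (Finset.mem_range.1 hi)
  have hu : T F ^ Fintype.card F ^ m = T F + bracket F m := by simp [bracket]
  rw [neg_pow, hu, add_pow, Finset.mul_sum, Finset.mul_sum, Finset.sum_mul,
    ← Finset.Ico_add_one_right_eq_Icc, Finset.sum_Ico_eq_sum_range, Nat.sub_add_comm hin]
  refine Finset.sum_congr rfl fun k _ => ?_
  have hchoose : (n.choose (i + k) : F⸨X⸩) * ((i + k).choose i : F⸨X⸩) =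
      n.choose i * (n - i).choose k := by
    have := Nat.choose_mul (n := n) (Nat.le_add_right i k)
    rw [Nat.add_sub_cancel_left] at this
    exact_mod_cast congrArg (Nat.cast (R := F⸨X⸩)) this
  rw [hyperD_X_pow, Nat.add_sub_cancel_left, Nat.sub_add_eq]
  linear_combination (-(-1) ^ (n - i) * T F ^ k * bracket F m ^ (n - i - k) *
    f.1 (PowerSeries.X ^ i)) * hchoose

theorem tendsto_diffCoeff (m : ℕ) (f : LC F) : Tendsto (diffCoeff m f) atTop (𝓝 0) := by
  refine (hasBasis_nhds_zero F).tendsto_right_iff.2 fun d _ => ?_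
  obtain ⟨J, hJ⟩ := exists_valuation_X_pow_mul_le f.2 d
  obtain ⟨r, hr⟩ := ((Finset.range J).image
    fun k => Valued.v (f.1 ((PowerSeries.X : F⟦X⟧) ^ k))).exists_le
  -- moments of index at least `J` are already small; for the others, bounded by `r`, the factor
  -- `u ^ (n - k)` has exponent at least `n - J`, which absorbs `r`
  filter_upwards [eventually_ge_atTop (J + (log r).toNat + d)] with n hn
  rw [diffCoeff_eq_sum]
  refine Valuation.map_sum_le _ fun k hk => ?_
  have hu : Valued.v ((-T F ^ Fintype.card F ^ m) ^ (n - k)) ≤ exp (-((n - k : ℕ) : ℤ)) := by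
    rw [map_pow, Valuation.map_neg, ← map_pow, ← pow_mul, valuation_T_pow, exp_le_exp]
    have : 1 ≤ Fintype.card F ^ m := Nat.one_le_pow _ _ Fintype.card_pos
    have := Nat.mul_le_mul_right (n - k) this
    omega
  have hcu : Valued.v ((n.choose k : F⸨X⸩) * (-T F ^ Fintype.card F ^ m) ^ (n - k)) ≤
      exp (-((n - k : ℕ) : ℤ)) := by
    rw [map_mul]
    exact (mul_le_of_le_one_left' (valuation_natCast_le_one _)).trans hu
  rw [map_mul]
  rcases le_or_gt J k with hk' | hk'
  · refine (mul_le_of_le_one_left' (hcu.trans ?_)).trans ?_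
    · rw [← exp_zero, exp_le_exp]
      omega
    · simpa using hJ k hk' 1
  · have hb : Valued.v (f.1 ((PowerSeries.X : F⟦X⟧) ^ k)) ≤ exp (log r) :=
      (hr _ (Finset.mem_image_of_mem _ (Finset.mem_range.2 hk'))).trans le_exp_log
    refine (mul_le_mul' hcu hb).trans ?_
    rw [← exp_add, exp_le_exp]
    omega

theorem tendstoUniformly_partialSum_diffCoeff (m : ℕ) (f : LC F) :
    TendstoUniformly (partialSum F m (diffCoeff m f)) f.1 atTop := by
  intro V hV
  rw [uniformity_eq_comap_nhds_zero, ((hasBasis_nhds_zero F).comap _).mem_iff] at hV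
  obtain ⟨d, -, hd⟩ := hV
  obtain ⟨M, hM⟩ := eventually_atTop.1
    ((hasBasis_nhds_zero F).tendsto_right_iff.1 (tendsto_diffCoeff m f) d trivial)
  filter_upwards [eventually_ge_atTop M] with N hN x
  refine hd ?_
  refine valuation_apply_le (Submodule.sub_mem _ (partialSum_mem_LC m (diffCoeff m f) N) f.2)
    (fun j => ?_) x
  rw [Pi.sub_apply]
  rcases lt_or_ge j N with hj | hj
  · rw [partialSum_X_pow_of_lt _ _ hj, partialSum_diffCoeff_X_pow, sub_self, map_zero]
    exact zero_le
  · rw [← partialSum_diffCoeff_X_pow m f j, Valuation.map_sub_swap, partialSum_X_pow,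
      partialSum_X_pow, ← Finset.sum_Ico_eq_sub _ (hj.trans j.le_succ)]
    refine Valuation.map_sum_le _ fun n hn => ?_
    rw [map_mul]
    refine (mul_le_of_le_one_left' ?_).trans (hM n (hN.trans (Finset.mem_Ico.1 hn).1))
    rw [map_mul, ← pow_mul, valuation_T_pow]
    refine mul_le_one' (valuation_natCast_le_one _) ?_
    rw [← exp_zero, exp_le_exp]
    omega

/-- Evaluating at powers of `T` gives a unitriangular system, which determines the coefficients. -/
theorem eq_of_partialSum_X_pow_eq (m : ℕ) {b c : ℕ → F⸨X⸩}
    (h : ∀ j : ℕ, partialSum F m b (j + 1) (PowerSeries.X ^ j) =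
      partialSum F m c (j + 1) (PowerSeries.X ^ j)) : b = c := by
  funext j
  induction j using Nat.strong_induction_on with
  | _ j ih =>
    have hj := h j
    rw [partialSum_X_pow, partialSum_X_pow, Finset.sum_range_succ, Finset.sum_range_succ,
      Finset.sum_congr rfl fun n hn => by rw [ih n (Finset.mem_range.1 hn)]] at hj
    simpa using hj

end Coefficients

end CarlitzExpansion

end

/-! ### Expansion of continuous linear functions -/

theorem theorem12 (F : Type*) [Field F] [Fintype F] (m : ℕ) (f : CarlitzExpansion.LC F) :
    ∃ β : ℕ → F⸨X⸩,
      -- the expansion, with coefficients tending to zero and uniform convergence on `O`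
      Tendsto β atTop (𝓝 0) ∧
      TendstoUniformly (CarlitzExpansion.partialSum F m β) f.1 atTop ∧
      -- uniqueness, even among pointwise expansions
      (∀ b : ℕ → F⸨X⸩,
        (∀ x : F⟦X⟧, Tendsto (fun N => CarlitzExpansion.partialSum F m b N x) atTop (𝓝 (f.1 x))) →
          b = β) ∧
      -- the two formulas for the coefficients
      ∀ n : ℕ,
        β n = (((CarlitzExpansion.carlitzDelta F
          - CarlitzExpansion.bracket F m • (1 : Module.End F⸨X⸩ (CarlitzExpansion.LC F))) ^ n) f).1
            (1 : F⟦X⟧) ∧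
        β n = ∑ i ∈ Finset.range (n + 1), ∑ j ∈ Finset.Icc i n,
          (-1 : F⸨X⸩) ^ (n - i) * (n.choose j : F⸨X⸩) * CarlitzExpansion.bracket F m ^ (n - j)
            * f.1 ((PowerSeries.X : F⟦X⟧) ^ i)
            * CarlitzExpansion.hyperD F i ((PowerSeries.X : F⟦X⟧) ^ j) := by
  open CarlitzExpansion in
  refine ⟨diffCoeff m f, tendsto_diffCoeff m f, tendstoUniformly_partialSum_diffCoeff m f,
    fun b hb => ?_, fun n => ⟨rfl, diffCoeff_eq_double_sum m f n⟩⟩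
  refine CarlitzExpansion.eq_of_partialSum_X_pow_eq m fun j => ?_
  rw [CarlitzExpansion.partialSum_diffCoeff_X_pow]
  refine tendsto_nhds_unique (tendsto_const_nhds.congr' ?_) (hb (PowerSeries.X ^ j))
  filter_upwards [eventually_gt_atTop j] with N hN
  exact (CarlitzExpansion.partialSum_X_pow_of_lt m b hN).symm
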